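/- Let $\Sigma$ be a finite nonempty alphabet and $L\subseteq\Sigma^*$ a regular language. A \emph{streaming algorithm} over an alphabet $\Delta$ for a language $K\subseteq\Delta^*$ is a deterministic, possibly infinite automaton accepting $K$, together with an injective encoding $\mathrm{enc}$ of its states by bit strings; $\mathcal A(u)$ denotes the state reached by $\mathcal A$ on input $u$ from the initial state. Fix $a\in\Sigma$. For $w\in\Sigma^*$ let $\mathrm{last}_n(w)$ be the suffix of length $n$ of $w$ if $|w|\ge n$, and $a^{n-|w|}w$ otherwise. For $s\colon\mathbb N\to\mathbb N$, the class $\mathsf F(s)$ consists of the languages $K\subseteq\Sigma^*$ for which there are streaming algorithms $\mathcal A_n$ ($n\ge 0$) such that, for each $n$, $\mathcal A_n$ is a streaming algorithm for $\{w\in\Sigma^*:\mathrm{last}_n(w)\in K\}$ all of whose states have encodings of length at most $s(n)$. Let $\overline\Sigma=\Sigma\cup\{\downarrow\}$, with $\downarrow$ a new symbol. The window $\mathrm{wnd}(u)\in\Sigma^*$ of a stream $u\in\overline\Sigma^*$ starts empty; reading $b\in\Sigma$ appends $b$ on the right, and reading $\downarrow$ removes the first symbol (if there is one). The class $\mathsf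 V(s)$ consists of the languages $K\subseteq\Sigma^*$ for which there is a streaming algorithm $\mathcal A$ for $\{u\in\overline\Sigma^*:\mathrm{wnd}(u)\in K\}$ such that, for every $n$ and every $u\in\overline\Sigma^*$ with $|\mathrm{wnd}(v)|\le n$ for all prefixes $v$ of $u$, one has $|\mathrm{enc}(\mathcal A(v))|\le s(n)$ for all prefixes $v$ of $u$. Put $\mathsf F(\mathcal O(\log n))=\bigcup_{s\in\mathcal O(\log n)}\mathsf F(s)$ and $\mathsf V(\mathcal O(\log n))=\bigcup_{s\in\mathcal O(\log n)}\mathsf V(s)$. A DFA (with finite state set, initial state $q_0$, transition function $\delta$, extended to words, and set $F$ of final states) is \emph{well-behaved} if for every strongly connected component $C$ reachable from $q_0$, every $q\in C$ and all words $u,v$ with $|u|=|v|$ and $\delta(q,u),\delta(q,v)\in C$, one has $\delta(q,u)\in F$ if and only if $\delta(q,v)\in F$. The language $L$ is \emph{$\leftarrow$-reducible} to $K\subseteq\Gamma^*$ if there is a finite-state Mealy machine with input alphabet $\Sigma$ and output alphabet $\Gamma$, computing (from its initial state) a length-preserving map $\tau\colon\Sigma^*\to\Gamma^*$, such that for all $x\in\Sigma^*$: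 $x\in L$ if and only if $\tau(x^{\mathsf R})^{\mathsf R}\in K$, where $^{\mathsf R}$ denotes reversal. A language $K$ over a finite alphabet has \emph{polynomial growth} if $|\{x\in K:|x|\le n\}|\in\mathcal O(n^d)$ for some $d\in\mathbb N$. A language $K\subseteq\Sigma^*$ is a \emph{left ideal} if $\Sigma^*K\subseteq K$, and a \emph{length language} if for every $n$ either $\Sigma^n\subseteq K$ or $K\cap\Sigma^n=\emptyset$. Theorem. The following are equivalent: 1. $L\in\mathsf F(\mathcal O(\log n))$; 2. $L\in\mathsf V(\mathcal O(\log n))$; 3. the reversal $L^{\mathsf R}=\{x^{\mathsf R}:x\in L\}$ is recognized by a well-behaved DFA; 4. $L$ is $\leftarrow$-reducible to a regular language of polynomial growth over some finite alphabet; 5. $L$ is a Boolean combination of regular left ideals and regular length languages over $\Sigma$. -/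

import Mathlib

namespace SlidingWindow

/-- A streaming algorithm over `α`: a deterministic, possibly infinite automaton (Mathlib's `DFA`
does not require finitely many states) together with an injective encoding of its states by bit
strings. As the states inject into the bit strings, `Type` is large enough for them. -/
structure StreamingAlgorithm (α : Type*) where
  State : Type
  aut : DFA α State
  enc : State → List Bool
  enc_injective : Function.Injective enc

/-- `𝒜` is a streaming algorithm for the language `L`. -/
def StreamingAlgorithm.IsFor {α : Type*} (A : StreamingAlgorithm α) (L : Language α) : Prop :=
  A.aut.accepts = L

/-- The space used on input `w`: the maximal encoding length of a state reached by a prefix. -/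
noncomputable def StreamingAlgorithm.space {α : Type*} (A : StreamingAlgorithm α)
    (w : List α) : ℕ∞ :=
  ⨆ (u : List α) (_ : u <+: w), ((A.enc (A.aut.eval u)).length : ℕ∞)

/-! ### Fixed-size sliding windows -/

/-- The active window of length `n`; the initial window is filled with the symbol `a`. -/
def lastWindow {α : Type*} (a : α) (n : ℕ) (w : List α) : List α :=
  List.replicate (n - w.length) a ++ w.drop (w.length - n)

/-- A fixed-size sliding window algorithm for `L` has one streaming algorithm per window size. -/
def IsFixedSizeAlgorithm {α : Type*} (a : α) (L : Language α)
    (A : ℕ → StreamingAlgorithm α) : Prop :=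
  ∀ n, (A n).IsFor {w : List α | lastWindow a n w ∈ L}

/-- The maximal encoding length of a state of the `n`-th algorithm. -/
noncomputable def fixedSpace {α : Type*} (A : ℕ → StreamingAlgorithm α) (n : ℕ) : ℕ∞ :=
  ⨆ q : (A n).State, (((A n).enc q).length : ℕ∞)

/-- Languages with a fixed-size sliding window algorithm of space complexity at most `s`. -/
def FixedSizeClass {α : Type*} (a : α) (s : ℕ → ℕ) : Set (Language α) :=
  {L | ∃ A : ℕ → StreamingAlgorithm α,
    IsFixedSizeAlgorithm a L A ∧ ∀ n, fixedSpace A n ≤ (s n : ℕ∞)}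

/-! ### Variable-size sliding windows -/

/-- The active window of a stream over the extended alphabet: `some a` is the arrival of the
symbol `a` and `none` is the expiration of the first symbol of the window. -/
def wnd {α : Type*} (u : List (Option α)) : List α :=
  u.foldl (fun w x => match x with
    | some a => w ++ [a]
    | none => w.tail) []

/-- A variable-size sliding window algorithm for `L`. -/
def IsVariableSizeAlgorithm {α : Type*} (L : Language α)
    (A : StreamingAlgorithm (Option α)) : Prop :=
  A.IsFor {u : List (Option α) | wnd u ∈ L}

/-- The maximal space used on streams all of whose windows have length at most `n`. -/
noncomputable def variableSpace {α : Type*} (A : StreamingAlgorithm (Option α)) (n : ℕ) : ℕ∞ :=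
  ⨆ (u : List (Option α)) (_ : ∀ v, v <+: u → (wnd v).length ≤ n), A.space u

/-- Languages with a variable-size sliding window algorithm of space complexity at most `s`. -/
def VariableSizeClass {α : Type*} (s : ℕ → ℕ) : Set (Language α) :=
  {L | ∃ A : StreamingAlgorithm (Option α),
    IsVariableSizeAlgorithm L A ∧ ∀ n, variableSpace A n ≤ (s n : ℕ∞)}

/-- The functions `s : ℕ → ℕ` in `O(log n)`, where `log n` is the rounded binary logarithm. -/
def bigOLog : Set (ℕ → ℕ) :=
  {s | (fun n => (s n : ℝ)) =O[Filter.atTop] (fun n => (Nat.log 2 n : ℝ))}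

/-- The class `F(O(log n))`. -/
def FixedLog {α : Type*} (a : α) : Set (Language α) :=
  ⋃ s ∈ bigOLog, FixedSizeClass a s

/-- The class `V(O(log n))`. -/
def VariableLog {α : Type*} : Set (Language α) :=
  ⋃ s ∈ bigOLog, VariableSizeClass s

/-! ### Well-behaved automata -/

/-- A strongly connected component: an inclusion-maximal set of mutually reachable states. -/
def IsSCC {α σ : Type*} (B : DFA α σ) (C : Set σ) : Prop :=
  Maximal (fun D : Set σ => ∀ p ∈ D, ∀ q ∈ D,
    ∃ u v : List α, B.evalFrom p u = q ∧ B.evalFrom q v = p) C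

/-- A well-behaved component: within it, acceptance depends on the start and the length only. -/
def WellBehavedSCC {α σ : Type*} (B : DFA α σ) (C : Set σ) : Prop :=
  ∀ q ∈ C, ∀ u v : List α, u.length = v.length → B.evalFrom q u ∈ C → B.evalFrom q v ∈ C →
    (B.evalFrom q u ∈ B.accept ↔ B.evalFrom q v ∈ B.accept)

/-- Every component that is reachable from the initial state is well-behaved. -/
def WellBehaved {α σ : Type*} (B : DFA α σ) : Prop :=
  ∀ C : Set σ, IsSCC B C → (∃ w : List α, B.eval w ∈ C) → WellBehavedSCC B C

/-- `L` is recognized by a well-behaved automaton with finitely many states. -/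
def RecognizedByWellBehavedDFA {α : Type*} (L : Language α) : Prop :=
  ∃ (σ : Type) (_ : Finite σ) (B : DFA α σ), WellBehaved B ∧ B.accepts = L

/-! ### Mealy machines -/

/-- A Mealy machine with input alphabet `α`, output alphabet `β` and state set `σ`. -/
structure MealyMachine (α β σ : Type*) where
  start : σ
  step : σ → α → σ × β

/-- The length-preserving transduction computed from the state `q`, reading left to right. -/
def MealyMachine.transduce {α β σ : Type*} (M : MealyMachine α β σ) : σ → List α → List β
  | _, [] => []
  | q, a :: u => (M.step q a).2 :: M.transduce (M.step q a).1 u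

/-- The transduction computed by the machine when it works from right to left. -/
def MealyMachine.leftTransduction {α β σ : Type*} (M : MealyMachine α β σ) (x : List α) :
    List β :=
  (M.transduce M.start x.reverse).reverse

/-- `K` is reducible to `L` by a finite-state Mealy machine working from right to left. -/
def LeftReducible {α β : Type*} (K : Language α) (L : Language β) : Prop :=
  ∃ (σ : Type) (_ : Finite σ) (M : MealyMachine α β σ),
    ∀ x : List α, x ∈ K ↔ M.leftTransduction x ∈ L

/-- The growth of `L`: the number of words of length at most `n`. -/
noncomputable def growth {β : Type*} (L : Language β) (n : ℕ) : ℕ :=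
  {x : List β | x ∈ L ∧ x.length ≤ n}.ncard

/-- Polynomial growth (used over finite alphabets only). -/
def PolynomialGrowth {β : Type*} (L : Language β) : Prop :=
  ∃ d : ℕ, (fun n => (growth L n : ℝ)) =O[Filter.atTop] (fun n : ℕ => (n : ℝ) ^ d)

/-! ### Ideals and length languages -/

/-- Left ideals: `Σ* L ⊆ L`. -/
def IsLeftIdeal {α : Type*} (L : Language α) : Prop :=
  (⊤ : Language α) * L ≤ L

/-- For each `n`, the language contains all words of length `n` or none of them. -/
def IsLengthLanguage {α : Type*} (L : Language α) : Prop :=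
  ∀ n : ℕ, (∀ w : List α, w.length = n → w ∈ L) ∨ (∀ w : List α, w.length = n → w ∉ L)

end SlidingWindow

/-!
All notions are compared with the well-behaved automata for the reversed language, which read a
window from its right end.

If an automaton is not well-behaved, it has a state with two loops of the same length such that
acceptance at a fixed position inside the loop tells them apart. A sequence of `k` such loops
encodes a bit string of length `k` whose bits can all be read off from the acceptance of prefixes.
A fixed-size window algorithm therefore has `2 ^ k` states for some window size linear in `k`, and
a Mealy machine reducing to a language `K` has `2 ^ k` outputs in `K` of length linear in `k`.

If an automaton is well-behaved, then membership depends only on the strongly connected component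
that is reached and on the length of the input modulo a suitable number. A component is named by the
set of states reachable from it. Along an input these sets decrease, so only polynomially many
sequences of them occur: they form the outputs of a reduction to a language of polynomial growth,
and a sliding window can be stored through them, since dropping its oldest symbol drops the last
set of each sequence. Moreover, the words whose reversal reaches a component below a given one form
a left ideal.

Conversely, acceptance by an automaton for the reversal of a left ideal is constant within a
component.
-/

namespace SlidingWindow

open Filter Asymptotics

variable {α σ : Type*}

/-! ### Asymptotics and counting -/

theorem not_isBigO_pow_of_pow_le {f : ℕ → ℝ} {b : ℝ} (hb : 1 < b) {c m : ℕ} (hm : 0 < m)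
    (hf : ∀ k, b ^ k ≤ f (c + m * k)) (d : ℕ) :
    ¬ f =O[atTop] (fun n : ℕ => (n : ℝ) ^ d) := by
  intro hpoly
  have hlim : Tendsto (fun k : ℕ => c + m * k) atTop atTop :=
    tendsto_atTop_mono
      (fun k => (Nat.le_mul_of_pos_left k hm).trans (Nat.le_add_left _ _)) tendsto_id
  have hexp : (fun k : ℕ => b ^ k) =O[atTop] (fun k => f (c + m * k)) :=
    isBigO_of_le _ fun k => by
      rw [Real.norm_of_nonneg (by positivity)]
      exact (hf k).trans (le_abs_self _)
  have hlinear : (fun k : ℕ => ((c + m * k : ℕ) : ℝ)) =O[atTop] (fun k : ℕ => (k : ℝ)) := by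
    refine IsBigO.of_bound (c + m : ℝ) ?_
    filter_upwards [eventually_ge_atTop 1] with k hk
    simp only [Real.norm_natCast]
    have : c + m * k ≤ (c + m) * k := by nlinarith
    exact_mod_cast this
  have : (fun k : ℕ => b ^ k) =o[atTop] (fun k : ℕ => b ^ k) :=
    ((hexp.trans (hpoly.comp_tendsto hlim)).trans (hlinear.pow d)).trans_isLittleO
      (isLittleO_pow_const_const_pow_of_one_lt d hb)
  exact isLittleO_irrefl (Frequently.of_forall fun k => by positivity) this

theorem isBigO_pow_of_le_succ_pow {f : ℕ → ℕ} {d : ℕ} (hf : ∀ n, f n ≤ (n + 1) ^ d) :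
    (fun n => (f n : ℝ)) =O[atTop] (fun n : ℕ => (n : ℝ) ^ d) := by
  refine IsBigO.of_bound (2 ^ d) ?_
  filter_upwards [eventually_ge_atTop 1] with n hn
  rw [Real.norm_natCast, Real.norm_of_nonneg (by positivity), ← mul_pow]
  have : f n ≤ (2 * n) ^ d := (hf n).trans (Nat.pow_le_pow_left (by omega) d)
  exact_mod_cast this

theorem exists_isBigO_pow_of_mem_bigOLog {s : ℕ → ℕ} (hs : s ∈ bigOLog) (c : ℕ) :
    ∃ d : ℕ, (fun n => ((c ^ s n : ℕ) : ℝ)) =O[atTop] (fun n : ℕ => (n : ℝ) ^ d) := by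
  obtain ⟨C, hC⟩ := IsBigO.bound hs
  refine ⟨⌈C⌉₊ * c, IsBigO.of_bound 1 ?_⟩
  filter_upwards [hC, eventually_ge_atTop 1] with n hn hn1
  rw [Real.norm_natCast, Real.norm_natCast] at hn
  have hlog : s n ≤ Nat.log 2 n * ⌈C⌉₊ := by
    have : (s n : ℝ) ≤ ⌈C⌉₊ * Nat.log 2 n :=
      hn.trans (mul_le_mul_of_nonneg_right (Nat.le_ceil C) (Nat.cast_nonneg _))
    rw [mul_comm]
    exact_mod_cast this
  rw [one_mul, Real.norm_natCast, Real.norm_of_nonneg (by positivity)]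
  have : c ^ s n ≤ n ^ (⌈C⌉₊ * c) := calc
    c ^ s n ≤ (2 ^ c) ^ s n := Nat.pow_le_pow_left Nat.lt_two_pow_self.le _
    _ = (2 ^ s n) ^ c := pow_right_comm _ _ _
    _ ≤ (2 ^ (Nat.log 2 n * ⌈C⌉₊)) ^ c := by gcongr; norm_num
    _ = (2 ^ Nat.log 2 n) ^ (⌈C⌉₊ * c) := by rw [pow_mul, pow_mul]
    _ ≤ n ^ (⌈C⌉₊ * c) := Nat.pow_le_pow_left (Nat.pow_log_le_self 2 (by omega)) _
  exact_mod_cast this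

theorem log_succ_mul_mem_bigOLog (c : ℕ) : (fun n => (Nat.log 2 n + 1) * c) ∈ bigOLog := by
  refine IsBigO.of_bound (2 * c : ℝ) ?_
  filter_upwards [eventually_ge_atTop 2] with n hn
  have hlog : 1 ≤ Nat.log 2 n := Nat.log_pos (by norm_num) hn
  rw [Real.norm_natCast, Real.norm_natCast]
  have : (Nat.log 2 n + 1) * c ≤ 2 * c * Nat.log 2 n := by nlinarith
  exact_mod_cast this

theorem comp_succ_mem_bigOLog {s : ℕ → ℕ} (hs : s ∈ bigOLog) :
    (fun n => s (n + 1)) ∈ bigOLog := by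
  refine (IsBigO.comp_tendsto hs (tendsto_add_atTop_nat 1)).trans (IsBigO.of_bound 2 ?_)
  filter_upwards [eventually_ge_atTop 2] with n hn
  have hlog : 1 ≤ Nat.log 2 n := Nat.log_pos (by norm_num) hn
  have hsucc : Nat.log 2 (n + 1) ≤ Nat.log 2 n + 1 := by
    rw [← Nat.log_mul_base (by norm_num) (by omega)]
    exact Nat.log_mono_right (by omega)
  simp only [Function.comp_apply, Real.norm_natCast]
  exact_mod_cast (by omega : Nat.log 2 (n + 1) ≤ 2 * Nat.log 2 n)

theorem natCard_le_succ_pow_of_length_le {X β : Type*} [Finite β] {enc : X → List β}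
    (hinj : Function.Injective enc) {N : ℕ} (hN : ∀ x, (enc x).length ≤ N) :
    Nat.card X ≤ (Nat.card β + 1) ^ N := by
  have h : Function.Injective fun (x : X) (i : Fin N) => (enc x)[(i : ℕ)]? := by
    intro x y hxy
    refine hinj (List.ext_getElem? fun i => ?_)
    by_cases hi : i < N
    · exact congrFun hxy ⟨i, hi⟩
    · rw [List.getElem?_eq_none ((hN x).trans (not_lt.mp hi)),
        List.getElem?_eq_none ((hN y).trans (not_lt.mp hi))]
  calc Nat.card X ≤ Nat.card (Fin N → Option β) := Nat.card_le_card_of_injective _ h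
    _ = (Nat.card β + 1) ^ N := by rw [Nat.card_fun, Finite.card_option, Nat.card_fin]

theorem exists_index_lt_of_encard_fiber_le {X : Type*} (size : X → ℕ) {N : ℕ → ℕ}
    (hN : ∀ n, {x | size x = n}.encard ≤ N n) :
    ∃ index : X → ℕ, (Function.Injective fun x => (size x, index x)) ∧
      ∀ x, index x < N (size x) := by
  have hindex (n : ℕ) : ∃ g : X → ℕ, {x | size x = n} ⊆ g ⁻¹' Set.Iio (N n) ∧
      Set.InjOn g {x | size x = n} := by
    refine (Set.finite_of_encard_le_coe (hN n)).exists_injOn_of_encard_le ?_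
    simpa [← Finset.coe_Iio, Set.encard_coe_eq_coe_finsetCard] using hN n
  choose g hlt hinj using hindex
  refine ⟨fun x => g (size x) x, fun x y hxy => ?_, fun x => hlt (size x) rfl⟩
  obtain ⟨hsize, hg⟩ := Prod.mk.inj hxy
  exact hinj (size x) rfl hsize.symm (by simpa only [hsize] using hg)

theorem natBits_injective : Function.Injective Nat.bits := fun m n h => by
  rw [← Nat.digits_inj_iff (b := 2), Nat.digits_two_eq_bits, Nat.digits_two_eq_bits, h]

theorem length_bits_pair_le {n i k : ℕ} (hi : i < (n + 1) ^ k) :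
    (Nat.bits (Nat.pair n i)).length ≤ (Nat.log 2 n + 1) * (2 * (k + 1)) := by
  have hmax : max n i + 1 ≤ (n + 1) ^ (k + 1) := by
    have : (n + 1) ^ k ≤ (n + 1) ^ (k + 1) := Nat.pow_le_pow_right (by omega) (by omega)
    have : n + 1 ≤ (n + 1) ^ (k + 1) := Nat.le_self_pow (by omega) _
    omega
  rw [Nat.size_eq_bits_len, Nat.size_le]
  calc Nat.pair n i < (max n i + 1) ^ 2 := Nat.pair_lt_max_add_one_sq _ _
    _ ≤ ((n + 1) ^ (k + 1)) ^ 2 := Nat.pow_le_pow_left hmax 2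
    _ ≤ ((2 ^ (Nat.log 2 n + 1)) ^ (k + 1)) ^ 2 := by
      gcongr
      exact Nat.lt_pow_succ_log_self (by norm_num) n
    _ = 2 ^ ((Nat.log 2 n + 1) * (2 * (k + 1))) := by
      rw [← pow_mul, ← pow_mul, mul_comm 2]

theorem exists_logarithmic_encoding {X : Type*} (size : X → ℕ) (k : ℕ)
    (hsize : ∀ n, {x | size x = n}.encard ≤ ((n + 1) ^ k : ℕ)) :
    ∃ enc : X → List Bool, Function.Injective enc ∧
      ∀ x, (enc x).length ≤ (Nat.log 2 (size x) + 1) * (2 * (k + 1)) := by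
  obtain ⟨index, hinj, hlt⟩ := exists_index_lt_of_encard_fiber_le size hsize
  refine ⟨fun x => Nat.bits (Nat.pair (size x) (index x)), fun x y hxy => ?_,
    fun x => length_bits_pair_le (hlt x)⟩
  have := Nat.pair_eq_pair.mp (natBits_injective hxy)
  exact hinj (Prod.ext this.1 this.2)

theorem encard_setOf_forall_mem_le {ι β : Type*} [Finite ι] {D : Set β} {N : ℕ}
    (hD : D.encard ≤ N) : {g : ι → β | ∀ i, g i ∈ D}.encard ≤ (N ^ Nat.card ι : ℕ) := by
  obtain ⟨hfin, hcard⟩ := Set.encard_le_coe_iff_finite_ncard_le.mp hD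
  refine Set.encard_le_coe_iff_finite_ncard_le.mpr ⟨Set.Finite.pi' fun _ => hfin, ?_⟩
  calc Nat.card {g : ι → β // ∀ i, g i ∈ D} = Nat.card (ι → D) :=
        Nat.card_congr Equiv.subtypePiEquivPi
    _ = D.ncard ^ Nat.card ι := Nat.card_fun
    _ ≤ N ^ Nat.card ι := Nat.pow_le_pow_left hcard _

/-- A decreasing word is determined by the number of occurrences of each letter. -/
theorem encard_pairwise_ge_le {T : Type*} [PartialOrder T] [Finite T] (n : ℕ) :
    {y : List T | y.Pairwise (· ≥ ·) ∧ y.length ≤ n}.encard ≤ ((n + 1) ^ Nat.card T : ℕ) := by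
  classical
  let count : {y : List T | y.Pairwise (· ≥ ·) ∧ y.length ≤ n} → T → Fin (n + 1) :=
    fun y t => ⟨y.1.count t, Nat.lt_succ_of_le (List.count_le_length.trans y.2.2)⟩
  have hcount : Function.Injective count := fun y z hyz => Subtype.ext <|
    (List.perm_iff_count.mpr fun t => congrArg Fin.val (congrFun hyz t)).eq_of_pairwise'
      y.2.1 z.2.1
  calc Set.encard _ ≤ ENat.card (T → Fin (n + 1)) := ENat.card_le_card_of_injective hcount
    _ = ((n + 1) ^ Nat.card T : ℕ) := by
      rw [ENat.card_eq_coe_natCard, Nat.card_fun, Nat.card_fin]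

/-! ### Well-behaved automata -/

theorem eval_append (B : DFA α σ) (x y : List α) :
    B.eval (x ++ y) = B.evalFrom (B.eval x) y :=
  B.evalFrom_of_append _ _ _

theorem eval_append_congr {B : DFA α σ} {x y : List α} (h : B.eval x = B.eval y) (z : List α) :
    B.eval (x ++ z) = B.eval (y ++ z) := by
  rw [eval_append, eval_append, h]

theorem evalFrom_flatten_of_loops {B : DFA α σ} {q : σ} {l : List (List α)}
    (hl : ∀ x ∈ l, B.evalFrom q x = q) : B.evalFrom q l.flatten = q := by
  induction l with
  | nil => rfl
  | cons x l ih =>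
    rw [List.forall_mem_cons] at hl
    rw [List.flatten_cons, B.evalFrom_of_append, hl.1, ih hl.2]

theorem isSCC_mutuallyReachable (B : DFA α σ) (q : σ) :
    IsSCC B {p | ∃ u v : List α, B.evalFrom q u = p ∧ B.evalFrom p v = q} := by
  refine ⟨?_, fun D hD hCD p hp => hD q (hCD ⟨[], [], rfl, rfl⟩) p hp⟩
  rintro p ⟨u, v, hu, hv⟩ p' ⟨u', v', hu', hv'⟩
  exact ⟨v ++ u', v' ++ u, by rw [B.evalFrom_of_append, hv, hu'],
    by rw [B.evalFrom_of_append, hv', hu]⟩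

theorem wellBehaved_iff {B : DFA α σ} :
    WellBehaved B ↔ ∀ w u v u' v' : List α, u.length = v.length →
      B.eval (w ++ u ++ u') = B.eval w → B.eval (w ++ v ++ v') = B.eval w →
      (w ++ u ∈ B.accepts ↔ w ++ v ∈ B.accepts) := by
  simp only [DFA.mem_accepts, eval_append]
  constructor
  · intro h w u v u' v' hlen hu hv
    exact h _ (isSCC_mutuallyReachable B (B.eval w)) ⟨w, [], [], rfl, rfl⟩ _ ⟨[], [], rfl, rfl⟩
      u v hlen ⟨u, u', rfl, hu⟩ ⟨v, v', rfl, hv⟩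
  · rintro h C hC ⟨w, hw⟩ q hq u v hlen hu hv
    obtain ⟨x, -, rfl, -⟩ := hC.prop _ hw _ hq
    obtain ⟨u', -, hu', -⟩ := hC.prop _ hu _ hq
    obtain ⟨v', -, hv', -⟩ := hC.prop _ hv _ hq
    rw [← eval_append] at hu' hv' ⊢
    exact h (w ++ x) u v u' v' hlen hu' hv'

/-- The obstruction to well-behavedness: two loops `head b ++ rest b` of the same positive length
at the state reached on `stem`, whose initial parts `head b` have the same length and lead to
acceptance for `b = true` only. -/
structure LoopFork (B : DFA α σ) where
  stem : List α
  head : Bool → List α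
  rest : Bool → List α
  headLength : ℕ
  blockLength : ℕ
  length_head : ∀ b, (head b).length = headLength
  length_block : ∀ b, (head b ++ rest b).length = blockLength
  blockLength_pos : 0 < blockLength
  loop : ∀ b, B.evalFrom (B.eval stem) (head b ++ rest b) = B.eval stem
  stem_append_head_mem_accepts : ∀ b, stem ++ head b ∈ B.accepts ↔ b = true

theorem nonempty_loopFork_of_not_wellBehaved {B : DFA α σ} (h : ¬ WellBehaved B) :
    Nonempty (LoopFork B) := by
  suffices key : ∀ w u v u' v' : List α, u.length = v.length →
      B.evalFrom (B.eval w) (u ++ u') = B.eval w → B.evalFrom (B.eval w) (v ++ v') = B.eval w →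
      w ++ u ∈ B.accepts → w ++ v ∉ B.accepts → Nonempty (LoopFork B) by
    rw [wellBehaved_iff] at h
    push Not at h
    obtain ⟨w, u, v, u', v', hlen, hu, hv, hne⟩ := h
    rw [List.append_assoc, eval_append] at hu hv
    rcases hne with ⟨hacc, hrej⟩ | ⟨hrej, hacc⟩
    · exact key w u v u' v' hlen hu hv hacc hrej
    · exact key w v u v' u' hlen.symm hv hu hacc hrej
  intro w u v u' v' hlen hu hv hacc hrej
  have hpos : 0 < u.length := by
    refine List.length_pos_of_ne_nil ?_
    rintro rfl
    rw [List.eq_nil_of_length_eq_zero (l := v) hlen.symm] at hrej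
    exact hrej hacc
  -- Appending each loop to the other one makes the lengths equal.
  exact ⟨{
    stem := w
    head := fun b => if b then u else v
    rest := fun b => if b then u' ++ (v ++ v') else v' ++ (u ++ u')
    headLength := u.length
    blockLength := (u ++ u' ++ (v ++ v')).length
    length_head := by simp [Bool.forall_bool, hlen]
    length_block := by simp [Bool.forall_bool]; omega
    blockLength_pos := by simp only [List.length_append]; omega
    loop := by
      simp only [Bool.forall_bool, Bool.false_eq_true, if_false, if_true]
      simp only [← List.append_assoc _ _ (_ ++ _), B.evalFrom_of_append _ (_ ++ _) (_ ++ _), hu, hv,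
        and_self]
    stem_append_head_mem_accepts := by simp [Bool.forall_bool, hacc, hrej] }⟩

namespace LoopFork

variable {B : DFA α σ} (F : LoopFork B)

/-- The word of loops that encodes a bit string. -/
def code (l : List Bool) : List α := l.flatMap fun b => F.head b ++ F.rest b

/-- The length of a prefix of `stem ++ code l` that ends after the head of the block with
index `i`; acceptance of this prefix reveals the bit with index `i`. -/
def cut (i : ℕ) : ℕ := F.stem.length + F.headLength + F.blockLength * i

theorem code_append (l l' : List Bool) : F.code (l ++ l') = F.code l ++ F.code l' :=
  List.flatMap_append

theorem length_code (l : List Bool) : (F.code l).length = F.blockLength * l.length := by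
  simp only [code, List.length_flatMap, F.length_block, List.map_const', List.sum_replicate,
    smul_eq_mul, mul_comm]

theorem evalFrom_code (l : List Bool) :
    B.evalFrom (B.eval F.stem) (F.code l) = B.eval F.stem :=
  evalFrom_flatten_of_loops <| List.forall_mem_map.mpr fun b _ => F.loop b

theorem length_stem_append_code_append_head (l : List Bool) (b : Bool) :
    (F.stem ++ F.code l ++ F.head b).length = F.cut l.length := by
  simp only [List.length_append, F.length_code, F.length_head, cut]
  ring

theorem stem_append_code_append_head_mem_accepts (l : List Bool) (b : Bool) :
    F.stem ++ F.code l ++ F.head b ∈ B.accepts ↔ b = true := by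
  have hcode : B.eval (F.stem ++ F.code l) = B.eval F.stem := by
    rw [eval_append, F.evalFrom_code]
  rw [← F.stem_append_head_mem_accepts b, DFA.mem_accepts, DFA.mem_accepts,
    eval_append_congr hcode]

theorem take_cut_mem_accepts (l : List Bool) {i : ℕ} (hi : i < l.length) (z : List α) :
    (F.stem ++ F.code l ++ z).take (F.cut i) ∈ B.accepts ↔ l[i] = true := by
  have hsplit : F.code l =
      F.code (l.take i) ++ F.head l[i] ++ (F.rest l[i] ++ F.code (l.drop (i + 1))) := by
    conv_lhs => rw [← List.take_append_drop i l, List.drop_eq_getElem_cons hi, code_append]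
    simp only [code, List.flatMap_cons, List.append_assoc]
  have hcut : (F.stem ++ F.code (l.take i) ++ F.head l[i]).length = F.cut i := by
    rw [F.length_stem_append_code_append_head, List.length_take, min_eq_left hi.le]
  rw [← F.stem_append_code_append_head_mem_accepts (l.take i), hsplit, ← hcut]
  simp only [← List.append_assoc]
  rw [List.append_assoc _ _ z, List.append_assoc _ _ (_ ++ z), List.take_left]

theorem cut_le_length_code {l : List Bool} {i : ℕ} (hi : i < l.length) :
    F.cut i ≤ (F.stem ++ F.code l).length := by
  have hhead : F.headLength ≤ F.blockLength := by
    rw [← F.length_head true, ← F.length_block true, List.length_append]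
    exact Nat.le_add_right _ _
  rw [List.length_append, F.length_code, cut]
  nlinarith [Nat.mul_le_mul_left F.blockLength (Nat.succ_le_of_lt hi)]

end LoopFork

/-! ### Boolean combinations of left ideals and length languages -/

theorem IsLeftIdeal.append_mem {K : Language α} (hK : IsLeftIdeal K) {x : List α} (hx : x ∈ K)
    (y : List α) : y ++ x ∈ K :=
  hK (Language.append_mem_mul (show y ∈ (⊤ : Language α) from trivial) hx)

theorem IsLeftIdeal.of_append_mem {K : Language α} (hK : ∀ x ∈ K, ∀ y : List α, y ++ x ∈ K) :
    IsLeftIdeal K := by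
  rintro _ ⟨y, -, x, hx, rfl⟩
  exact hK x hx y

theorem IsLengthLanguage.mem_iff {K : Language α} (hK : IsLengthLanguage K) {x y : List α}
    (hxy : x.length = y.length) : x ∈ K ↔ y ∈ K := by
  rcases hK y.length with hall | hnone
  · exact iff_of_true (hall x hxy) (hall y rfl)
  · exact iff_of_false (hnone x hxy) (hnone y rfl)

theorem wellBehaved_of_isLeftIdeal {K : Language α} (hK : IsLeftIdeal K) {B : DFA α σ}
    (hB : B.accepts = K.reverse) : WellBehaved B := by
  have key (w u v u' : List α) (hu : B.eval (w ++ u ++ u') = B.eval w)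
      (hmem : w ++ u ∈ B.accepts) : w ++ v ∈ B.accepts := by
    have hext : w ++ u ++ (u' ++ v) ∈ B.accepts := by
      rw [hB, Language.mem_reverse] at hmem ⊢
      rw [List.reverse_append]
      exact hK.append_mem hmem _
    rwa [← List.append_assoc, DFA.mem_accepts, eval_append_congr hu] at hext
  rw [wellBehaved_iff]
  intro w u v u' v' _ hu hv
  exact ⟨key w u v u' hu, key w v u v' hv⟩

theorem wellBehaved_of_isLengthLanguage {K : Language α} (hK : IsLengthLanguage K)
    {B : DFA α σ} (hB : B.accepts = K.reverse) : WellBehaved B := by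
  rw [wellBehaved_iff, hB]
  intro w u v u' v' hlen _ _
  exact hK.mem_iff (by simp [hlen])

universe v in
theorem eval_union {σ τ : Type v} (B : DFA α σ) (B' : DFA α τ) (x : List α) :
    (B.union B').eval x = (B.eval x, B'.eval x) := by
  induction x using List.reverseRecOn with
  | nil => rfl
  | append_singleton x b ih => rw [DFA.eval_append_singleton, ih, DFA.eval_append_singleton,
      DFA.eval_append_singleton, DFA.union]

theorem recognizedByWellBehavedDFA_bot : RecognizedByWellBehavedDFA (⊥ : Language α) :=
  ⟨Unit, inferInstance, ⟨fun _ _ => (), (), ∅⟩, fun _ _ _ _ _ _ _ _ _ _ => Iff.rfl, rfl⟩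

theorem RecognizedByWellBehavedDFA.sup {K K' : Language α}
    (h : RecognizedByWellBehavedDFA K) (h' : RecognizedByWellBehavedDFA K') :
    RecognizedByWellBehavedDFA (K ⊔ K') := by
  obtain ⟨σ, _, B, hB, rfl⟩ := h
  obtain ⟨σ', _, B', hB', rfl⟩ := h'
  refine ⟨σ × σ', inferInstance, B.union B', ?_, B.accepts_union B'⟩
  rw [wellBehaved_iff] at hB hB' ⊢
  intro w u v u' v' hlen hu hv
  simp only [eval_union, Prod.mk.injEq] at hu hv
  rw [DFA.accepts_union]
  exact or_congr (hB w u v u' v' hlen hu.1 hv.1) (hB' w u v u' v' hlen hu.2 hv.2)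

theorem RecognizedByWellBehavedDFA.compl {K : Language α} (h : RecognizedByWellBehavedDFA K) :
    RecognizedByWellBehavedDFA Kᶜ := by
  obtain ⟨σ, _, B, hB, rfl⟩ := h
  refine ⟨σ, inferInstance, Bᶜ, ?_, B.accepts_compl⟩
  rw [wellBehaved_iff] at hB ⊢
  intro w u v u' v' hlen hu hv
  rw [DFA.accepts_compl]
  exact not_congr (hB w u v u' v' hlen hu hv)

/-- The languages whose Boolean combinations the theorem speaks about: the regular left ideals and
the regular length languages over `α`. -/
abbrev regularGenerators (α : Type*) : Set (Language α) :=
  {K | K.IsRegular ∧ (IsLeftIdeal K ∨ IsLengthLanguage K)}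

theorem recognizedByWellBehavedDFA_reverse_of_mem_closure {L : Language α}
    (h : L ∈ BooleanSubalgebra.closure (regularGenerators α)) :
    RecognizedByWellBehavedDFA L.reverse := by
  induction h using BooleanSubalgebra.closure_bot_sup_induction with
  | mem K hK =>
    obtain ⟨hreg, hK⟩ := hK
    obtain ⟨σ, _, B, hB⟩ := hreg.reverse
    exact ⟨σ, inferInstance, B, hK.elim (wellBehaved_of_isLeftIdeal · hB)
      (wellBehaved_of_isLengthLanguage · hB), hB⟩
  | bot => exact recognizedByWellBehavedDFA_bot
  | sup _ _ _ _ h h' => exact h.sup h'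
  | compl _ _ h => exact h.compl

/-! ### Fixed-size windows -/

theorem lastWindow_reverse_of_length_le (a : α) {n : ℕ} {x : List α} (hx : n ≤ x.length) :
    lastWindow a n x.reverse = (x.take n).reverse := by
  rw [lastWindow, List.length_reverse, Nat.sub_eq_zero_of_le hx, List.replicate_zero,
    List.nil_append, List.reverse_take]

theorem fixedSpace_le_iff {A : ℕ → StreamingAlgorithm α} {n s : ℕ} :
    fixedSpace A n ≤ s ↔ ∀ q, ((A n).enc q).length ≤ s := by
  simp only [fixedSpace, iSup_le_iff, Nat.cast_le]

theorem LoopFork.reverse_lastWindow_mem_accepts {B : DFA α σ} (F : LoopFork B) (a : α)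
    (l : List Bool) {i : ℕ} (hi : i < l.length) :
    (lastWindow a (F.cut l.length)
      ((F.code l).reverse ++ (F.stem ++ F.code (.replicate (l.length - i) true)).reverse)).reverse
        ∈ B.accepts ↔ l[i] = true := by
  have hword : F.stem ++ F.code (.replicate (l.length - i) true) ++ F.code l =
      F.stem ++ F.code (.replicate (l.length - i) true ++ l) ++ [] := by
    rw [code_append, List.append_assoc, List.append_nil]
  have hk : l.length < (List.replicate (l.length - i) true ++ l).length := by
    rw [List.length_append, List.length_replicate]
    omega
  rw [← List.reverse_append, hword, lastWindow_reverse_of_length_le _ (by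
      rw [List.append_nil]; exact F.cut_le_length_code hk),
    List.reverse_reverse, F.take_cut_mem_accepts _ hk]
  simp only [List.getElem_append_right (List.length_replicate.trans_le (Nat.sub_le _ i)),
    List.length_replicate, Nat.sub_sub_self hi.le]

/-- Reading `γ` first, a window of fixed length can later be shifted to reveal any bit of `γ`. -/
theorem LoopFork.injective_eval_code_ofFn {L : Language α} {B : DFA α σ} (F : LoopFork B)
    (hB : B.accepts = L.reverse) (a : α) {k : ℕ} {A : StreamingAlgorithm α}
    (hA : A.IsFor {w : List α | lastWindow a (F.cut k) w ∈ L}) :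
    Function.Injective fun γ : Fin k → Bool => A.aut.eval (F.code (List.ofFn γ)).reverse := by
  have hbit (γ : Fin k → Bool) (i : Fin k) :
      A.aut.eval ((F.code (List.ofFn γ)).reverse ++
        (F.stem ++ F.code (.replicate (k - i) true)).reverse) ∈ A.aut.accept ↔ γ i = true := by
    have h := F.reverse_lastWindow_mem_accepts a (List.ofFn γ) (i := i) (by simp)
    simp only [hB, Language.mem_reverse, List.reverse_reverse, List.getElem_ofFn, List.length_ofFn]
      at h
    rw [← DFA.mem_accepts, hA]
    exact h
  intro γ δ hγδ
  funext i
  rw [Bool.eq_iff_iff, ← hbit γ i, ← hbit δ i, eval_append_congr hγδ]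

theorem wellBehaved_of_mem_fixedLog {L : Language α} {B : DFA α σ} (hB : B.accepts = L.reverse)
    {a : α} (hL : L ∈ FixedLog a) : WellBehaved B := by
  by_contra hnot
  obtain ⟨F⟩ := nonempty_loopFork_of_not_wellBehaved hnot
  obtain ⟨s, hs, A, hA, hspace⟩ := Set.mem_iUnion₂.mp hL
  have hstates (k : ℕ) : 2 ^ k ≤ 3 ^ s (F.cut k) := by
    have h := natCard_le_succ_pow_of_length_le
      ((A _).enc_injective.comp (F.injective_eval_code_ofFn hB a (hA (F.cut k))))
      fun γ => fixedSpace_le_iff.mp (hspace (F.cut k)) _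
    simpa using h
  obtain ⟨d, hd⟩ := exists_isBigO_pow_of_mem_bigOLog hs 3
  exact not_isBigO_pow_of_pow_le one_lt_two F.blockLength_pos
    (fun k => by exact_mod_cast hstates k) d hd

/-! ### Mealy machines -/

section Mealy

variable {β τ : Type*}

namespace MealyMachine

theorem length_transduce (M : MealyMachine α β τ) (s : τ) (x : List α) :
    (M.transduce s x).length = x.length := by
  induction x generalizing s with
  | nil => rfl
  | cons a x ih => exact congrArg (· + 1) (ih _)

theorem transduce_take (M : MealyMachine α β τ) (s : τ) (x : List α) (n : ℕ) :
    M.transduce s (x.take n) = (M.transduce s x).take n := by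
  induction x generalizing s n with
  | nil => simp only [List.take_nil, MealyMachine.transduce]
  | cons a x ih =>
    cases n with
    | zero => rfl
    | succ n => exact congrArg _ (ih _ n)

theorem transduce_dropLast (M : MealyMachine α β τ) (s : τ) (x : List α) :
    M.transduce s x.dropLast = (M.transduce s x).dropLast := by
  rw [List.dropLast_eq_take, List.dropLast_eq_take, transduce_take, length_transduce]

/-- The automaton that runs `G` on the output of the Mealy machine `M`. -/
def thenDFA (M : MealyMachine α β τ) (G : DFA β σ) : DFA α (τ × σ) :=
  ⟨fun p a => ((M.step p.1 a).1, G.step p.2 (M.step p.1 a).2), (M.start, G.start),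
    {p | p.2 ∈ G.accept}⟩

theorem snd_evalFrom_thenDFA (M : MealyMachine α β τ) (G : DFA β σ) (p : τ × σ) (x : List α) :
    ((M.thenDFA G).evalFrom p x).2 = G.evalFrom p.2 (M.transduce p.1 x) := by
  induction x generalizing p with
  | nil => rfl
  | cons a _ ih => exact ih _

theorem mem_accepts_thenDFA {M : MealyMachine α β τ} {G : DFA β σ} {x : List α} :
    x ∈ (M.thenDFA G).accepts ↔ M.transduce M.start x ∈ G.accepts := by
  rw [DFA.mem_accepts, DFA.mem_accepts, DFA.eval, DFA.eval]
  exact iff_of_eq (congrArg (· ∈ G.accept) (snd_evalFrom_thenDFA M G (M.start, G.start) x))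

theorem two_pow_le_growth_cut [Finite β] {K : Language β} (M : MealyMachine α β τ) {G : DFA β σ}
    (hG : G.accepts = K.reverse) (F : LoopFork (M.thenDFA G)) (k : ℕ) :
    2 ^ k ≤ growth K (F.cut k) := by
  let input (γ : Fin k → Bool) : List α := F.stem ++ F.code (List.ofFn γ) ++ F.head true
  let output (γ : Fin k → Bool) : List β := (M.transduce M.start (input γ)).reverse
  have houtput_mem (γ : Fin k → Bool) : output γ ∈ {y | y ∈ K ∧ y.length ≤ F.cut k} := by
    have haccept : input γ ∈ (M.thenDFA G).accepts :=
      (F.stem_append_code_append_head_mem_accepts _ true).mpr rfl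
    rw [mem_accepts_thenDFA, hG, Language.mem_reverse] at haccept
    refine ⟨haccept, ?_⟩
    rw [List.length_reverse, length_transduce, F.length_stem_append_code_append_head,
      List.length_ofFn]
  have houtput_inj : Function.Injective output := by
    have hbit (γ : Fin k → Bool) (i : Fin k) :
        (output γ).reverse.take (F.cut i) ∈ G.accepts ↔ γ i = true := by
      rw [List.reverse_reverse, ← transduce_take, ← mem_accepts_thenDFA,
        F.take_cut_mem_accepts (List.ofFn γ) (by simp), List.getElem_ofFn]
    intro γ δ hγδ
    funext i
    rw [Bool.eq_iff_iff, ← hbit γ i, ← hbit δ i, hγδ]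
  have hfin : {y | y ∈ K ∧ y.length ≤ F.cut k}.Finite :=
    (List.finite_length_le β (F.cut k)).subset fun _ hy => hy.2
  calc 2 ^ k = Nat.card (Fin k → Bool) := by simp
    _ = (Set.range output).ncard := (Set.ncard_range_of_injective houtput_inj).symm
    _ ≤ growth K (F.cut k) := Set.ncard_le_ncard (Set.range_subset_iff.mpr houtput_mem) hfin

theorem wellBehaved_thenDFA [Finite β] {K : Language β} (hK : PolynomialGrowth K)
    (M : MealyMachine α β τ) {G : DFA β σ} (hG : G.accepts = K.reverse) :
    WellBehaved (M.thenDFA G) := by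
  by_contra hnot
  obtain ⟨F⟩ := nonempty_loopFork_of_not_wellBehaved hnot
  obtain ⟨d, hd⟩ := hK
  exact not_isBigO_pow_of_pow_le one_lt_two F.blockLength_pos
    (fun k => by exact_mod_cast two_pow_le_growth_cut M hG F k) d hd

end MealyMachine

open MealyMachine in
theorem LeftReducible.recognizedByWellBehavedDFA_reverse [Finite β] {L : Language α}
    {K : Language β} (hL : LeftReducible L K) (hreg : K.IsRegular) (hK : PolynomialGrowth K) :
    RecognizedByWellBehavedDFA L.reverse := by
  obtain ⟨τ, _, M, hM⟩ := hL
  obtain ⟨σ, _, G, hG⟩ := hreg.reverse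
  refine ⟨τ × σ, inferInstance, M.thenDFA G, wellBehaved_thenDFA hK M hG, ?_⟩
  ext x
  rw [mem_accepts_thenDFA, hG, Language.mem_reverse, Language.mem_reverse, hM,
    MealyMachine.leftTransduction, List.reverse_reverse]

end Mealy

/-! ### Reachability classes -/

/-- The states reachable from `s`. Two states have the same set of reachable states if and only if
they lie in the same strongly connected component, so these sets serve as names of components. -/
def reachSet (M : DFA α σ) (s : σ) : Set σ := Set.range (M.evalFrom s)

theorem mem_reachSet_self (M : DFA α σ) (s : σ) : s ∈ reachSet M s := ⟨[], rfl⟩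

theorem reachSet_evalFrom_le (M : DFA α σ) (s : σ) (x : List α) :
    reachSet M (M.evalFrom s x) ≤ reachSet M s := by
  rintro _ ⟨y, rfl⟩
  exact ⟨x ++ y, M.evalFrom_of_append _ _ _⟩

theorem exists_eval_append_eq_of_reachSet_eq {M : DFA α σ} {x y : List α}
    (h : reachSet M (M.eval x) = reachSet M (M.eval y)) : ∃ u, M.eval (x ++ u) = M.eval y := by
  obtain ⟨u, hu⟩ := h.ge (mem_reachSet_self M (M.eval y))
  exact ⟨u, (eval_append M x u).trans hu⟩

/-- The component reached on `x`, together with the length of `x` modulo `d`. -/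
def reachClass (M : DFA α σ) (d : ℕ) (x : List α) : Set σ × ZMod d :=
  (reachSet M (M.eval x), x.length)

/-- The product of `B` with a counter of the input length modulo `d`. -/
def withCounter (B : DFA α σ) (d : ℕ) : DFA α (σ × ZMod d) where
  step p b := (B.step p.1 b, p.2 + 1)
  start := (B.start, 0)
  accept := {p | p.1 ∈ B.accept}

theorem eval_withCounter (B : DFA α σ) (d : ℕ) (x : List α) :
    (withCounter B d).eval x = (B.eval x, (x.length : ZMod d)) := by
  induction x using List.reverseRecOn with
  | nil => exact congrArg (B.start, ·) Nat.cast_zero.symm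
  | append_singleton x b ih =>
    rw [DFA.eval_append_singleton, ih, DFA.eval_append_singleton, List.length_append,
      List.length_singleton, Nat.cast_succ, withCounter]

theorem exists_pos_forall_dvd_exists_loop [Finite σ] (B : DFA α σ) :
    ∃ d > 0, ∀ (q : σ) (x : List α), x ≠ [] → B.evalFrom q x = q →
      ∀ n, d ∣ n → ∃ z : List α, z.length = n ∧ B.evalFrom q z = q := by
  have := Fintype.ofFinite σ
  have hstate (q : σ) : ∃ r > 0, ∀ x : List α, x ≠ [] → B.evalFrom q x = q →
      ∃ z : List α, z.length = r ∧ B.evalFrom q z = q := by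
    by_cases hq : ∃ x : List α, x ≠ [] ∧ B.evalFrom q x = q
    · obtain ⟨z, hz, hzq⟩ := hq
      exact ⟨z.length, List.length_pos_of_ne_nil hz, fun _ _ _ => ⟨z, rfl, hzq⟩⟩
    · exact ⟨1, one_pos, fun x hx hxq => (hq ⟨x, hx, hxq⟩).elim⟩
  choose r hr hloop using hstate
  refine ⟨∏ q, r q, Finset.prod_pos fun q _ => hr q, fun q x hx hxq n hn => ?_⟩
  obtain ⟨z, hz, hzq⟩ := hloop q x hx hxq
  obtain ⟨m, rfl⟩ := (Finset.dvd_prod_of_mem r (Finset.mem_univ q)).trans hn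
  refine ⟨(List.replicate m z).flatten, ?_,
    evalFrom_flatten_of_loops fun y hy => (List.eq_of_mem_replicate hy).symm ▸ hzq⟩
  rw [List.length_flatten, List.map_replicate, List.sum_replicate, hz, smul_eq_mul, mul_comm]

theorem WellBehaved.append_mem_accepts_iff {B : DFA α σ} (hB : WellBehaved B) {x u v z : List α}
    (hback : B.eval (x ++ u ++ v) = B.eval x) (hz : B.evalFrom (B.eval x) z = B.eval x)
    (hlen : u.length = z.length) : x ++ u ∈ B.accepts ↔ x ∈ B.accepts := by
  rw [← eval_append] at hz
  rw [wellBehaved_iff.mp hB x u z v [] hlen hback (by rw [List.append_nil, hz]),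
    DFA.mem_accepts, hz, DFA.mem_accepts]

/-- Counting modulo a common multiple of loop lengths, a path between two inputs of the same class
is as long as some loop at its origin, and well-behavedness compares the path with that loop. -/
theorem WellBehaved.exists_mem_accepts_iff_of_reachClass_eq [Finite σ] {B : DFA α σ}
    (hB : WellBehaved B) : ∃ d > 0, ∀ x y, reachClass (withCounter B d) d x =
      reachClass (withCounter B d) d y → (x ∈ B.accepts ↔ y ∈ B.accepts) := by
  obtain ⟨d, hd, hloop⟩ := exists_pos_forall_dvd_exists_loop B
  refine ⟨d, hd, fun x y hxy => ?_⟩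
  obtain ⟨hreach, hlen⟩ := Prod.mk.inj hxy
  obtain ⟨u, hu⟩ := exists_eval_append_eq_of_reachSet_eq hreach
  obtain ⟨v, hv⟩ := exists_eval_append_eq_of_reachSet_eq hreach.symm
  simp only [eval_withCounter, Prod.mk.injEq] at hu hv
  have hdvd : d ∣ u.length := by
    rw [← ZMod.natCast_eq_zero_iff]
    simpa [hlen] using hu.2
  have hback : B.eval (x ++ u ++ v) = B.eval x := (eval_append_congr hu.1 v).trans hv.1
  have hxu : x ++ u ∈ B.accepts ↔ x ∈ B.accepts := by
    by_cases hnil : u = []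
    · rw [hnil, List.append_nil]
    · rw [List.append_assoc, eval_append] at hback
      obtain ⟨z, hz, hzloop⟩ :=
        hloop _ (u ++ v) (List.append_ne_nil_of_left_ne_nil hnil v) hback _ hdvd
      rw [← eval_append, ← List.append_assoc] at hback
      exact hB.append_mem_accepts_iff hback hzloop hz.symm
  rw [← hxu, DFA.mem_accepts, hu.1, DFA.mem_accepts]

theorem RecognizedByWellBehavedDFA.exists_reachClass_mem_iff {K : Language α}
    (h : RecognizedByWellBehavedDFA K) :
    ∃ (σ : Type) (_ : Finite σ) (M : DFA α σ) (d : ℕ) (_ : NeZero d) (S : Set (Set σ × ZMod d)),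
      ∀ x, x ∈ K ↔ reachClass M d x ∈ S := by
  obtain ⟨σ, _, B, hB, rfl⟩ := h
  obtain ⟨d, hd, hdet⟩ := hB.exists_mem_accepts_iff_of_reachClass_eq
  have : NeZero d := ⟨hd.ne'⟩
  refine ⟨σ × ZMod d, inferInstance, withCounter B d, d, this,
    reachClass (withCounter B d) d '' {x | x ∈ B.accepts},
    fun x => ⟨Set.mem_image_of_mem _, ?_⟩⟩
  rintro ⟨y, hy, hyx⟩
  exact (hdet y x hyx).mp hy

/-! ### Decomposition into left ideals and length languages -/

theorem isRegular_of_mem_iff_of_append_congr {X : Type*} [Finite X] {K : Language α}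
    {f : List α → X} (hf : ∀ x y b, f x = f y → f (x ++ [b]) = f (y ++ [b])) {S : Set X}
    (hK : ∀ x, x ∈ K ↔ f x ∈ S) : K.IsRegular := by
  have happend (z x y : List α) (h : f x = f y) : f (x ++ z) = f (y ++ z) := by
    induction z using List.reverseRecOn with
    | nil => simpa only [List.append_nil] using h
    | append_singleton z b ih =>
      rw [← List.append_assoc, ← List.append_assoc]
      exact hf _ _ _ ih
  have hfactors : Function.FactorsThrough K.leftQuotient f := fun x y h => by
    ext z
    rw [Language.mem_leftQuotient, Language.mem_leftQuotient, hK, hK, happend z x y h]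
  refine .of_finite_range_leftQuotient ?_
  rw [← hfactors.extend_comp (e' := fun _ => 0), Set.range_comp]
  exact Set.toFinite _

/-- The words whose reversal leads `M` to a component in `U`. -/
def reachIdeal (M : DFA α σ) (U : Set (Set σ)) : Language α :=
  {x | reachSet M (M.eval x.reverse) ∈ U}

theorem isRegular_reachIdeal [Finite σ] (M : DFA α σ) (U : Set (Set σ)) :
    (reachIdeal M U).IsRegular := by
  refine .of_reverse (isRegular_of_mem_iff_of_append_congr (f := M.eval)
    (fun x y b h => eval_append_congr h [b]) (S := {s | reachSet M s ∈ U}) fun x => ?_)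
  rw [Language.mem_reverse]
  change reachSet M (M.eval x.reverse.reverse) ∈ U ↔ _
  rw [List.reverse_reverse]
  rfl

theorem isLeftIdeal_reachIdeal (M : DFA α σ) {U : Set (Set σ)} (hU : IsLowerSet U) :
    IsLeftIdeal (reachIdeal M U) := by
  refine .of_append_mem fun x hx y => ?_
  change reachSet M (M.eval (y ++ x).reverse) ∈ U
  rw [List.reverse_append, eval_append]
  exact hU (reachSet_evalFrom_le M _ _) hx

/-- The words of length `r` modulo `d`. -/
def residueLanguage (α : Type*) {d : ℕ} (r : ZMod d) : Language α :=
  {x | (x.length : ZMod d) = r}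

theorem isRegular_residueLanguage {d : ℕ} [NeZero d] (r : ZMod d) :
    (residueLanguage α r).IsRegular :=
  isRegular_of_mem_iff_of_append_congr (f := fun x : List α => (x.length : ZMod d))
    (fun x y b h => by simpa using h) (S := {r}) fun _ => Iff.rfl

theorem isLengthLanguage_residueLanguage {d : ℕ} (r : ZMod d) :
    IsLengthLanguage (residueLanguage α r) := fun n =>
  (em ((n : ZMod d) = r)).imp
    (fun hn _ hw => (congrArg Nat.cast hw).trans hn)
    (fun hn _ hw hr => hn ((congrArg Nat.cast hw).symm.trans hr))

theorem eq_iSup_reachIdeal_sdiff_inf_residueLanguage {L : Language α} {M : DFA α σ} {d : ℕ}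
    {S : Set (Set σ × ZMod d)} (hS : ∀ x, x ∈ L.reverse ↔ reachClass M d x ∈ S) :
    L = ⨆ p : S, (reachIdeal M (Set.Iic p.1.1) \ reachIdeal M (Set.Iio p.1.1)) ⊓
      residueLanguage α p.1.2 := by
  have hlength (x : List α) : (x.reverse.length : ZMod d) = x.length := by
    rw [List.length_reverse]
  ext x
  rw [← Language.reverse_mem_reverse, hS]
  constructor
  · intro hx
    have hself : reachSet M (M.eval x.reverse) ≤ reachSet M (M.eval x.reverse) := le_rfl
    exact Set.mem_iUnion.mpr ⟨⟨_, hx⟩, ⟨hself, hself.not_gt⟩, (hlength x).symm⟩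
  · intro hx
    obtain ⟨⟨⟨t, r⟩, hp⟩, ⟨hle, hnlt⟩, hr⟩ := Set.mem_iUnion.mp hx
    have ht : reachSet M (M.eval x.reverse) = t := eq_of_le_of_not_lt hle hnlt
    rwa [reachClass, ht, (hlength x).trans hr]

theorem RecognizedByWellBehavedDFA.mem_closure {L : Language α}
    (h : RecognizedByWellBehavedDFA L.reverse) :
    L ∈ BooleanSubalgebra.closure (regularGenerators α) := by
  obtain ⟨σ, _, M, d, _, S, hS⟩ := h.exists_reachClass_mem_iff
  have hideal {U : Set (Set σ)} (hU : IsLowerSet U) :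
      reachIdeal M U ∈ BooleanSubalgebra.closure (regularGenerators α) :=
    BooleanSubalgebra.subset_closure
      ⟨isRegular_reachIdeal M U, .inl (isLeftIdeal_reachIdeal M hU)⟩
  have hresidue (r : ZMod d) :
      residueLanguage α r ∈ BooleanSubalgebra.closure (regularGenerators α) :=
    BooleanSubalgebra.subset_closure
      ⟨isRegular_residueLanguage r, .inr (isLengthLanguage_residueLanguage r)⟩
  rw [eq_iSup_reachIdeal_sdiff_inf_residueLanguage hS]
  exact BooleanSubalgebra.iSup_mem fun p => BooleanSubalgebra.inf_mem
    (BooleanSubalgebra.sdiff_mem (hideal (isLowerSet_Iic _)) (hideal (isLowerSet_Iio _)))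
    (hresidue _)

/-! ### The reduction that outputs reachability classes -/

/-- The Mealy machine that runs `M` and outputs the sets of reachable states. -/
def reachMealy (M : DFA α σ) : MealyMachine α (Set σ) σ where
  start := M.start
  step s b := (M.step s b, reachSet M (M.step s b))

theorem isChain_cons_transduce_reachMealy (M : DFA α σ) (s : σ) (x : List α) :
    (reachSet M s :: (reachMealy M).transduce s x).IsChain (· ≥ ·) := by
  induction x generalizing s with
  | nil => exact List.isChain_singleton _
  | cons b x ih => exact List.isChain_cons_cons.mpr ⟨reachSet_evalFrom_le M s [b], ih _⟩

theorem pairwise_transduce_reachMealy (M : DFA α σ) (s : σ) (x : List α) :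
    ((reachMealy M).transduce s x).Pairwise (· ≥ ·) :=
  (List.isChain_iff_pairwise.mp (isChain_cons_transduce_reachMealy M s x)).of_cons

theorem getLastD_transduce_reachMealy (M : DFA α σ) (s : σ) (x : List α) :
    ((reachMealy M).transduce s x).getLastD (reachSet M s) = reachSet M (M.evalFrom s x) := by
  induction x generalizing s with
  | nil => rfl
  | cons b x ih => exact List.getLastD_cons.trans (ih _)

/-- The decreasing words of sets of states whose last letter (initially `reachSet M M.start`) and
length modulo `d` form a class in `S`. -/
def reachLanguage (M : DFA α σ) {d : ℕ} (S : Set (Set σ × ZMod d)) : Language (Set σ) :=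
  {y | (reachSet M M.start :: y).IsChain (· ≥ ·) ∧
    (y.getLastD (reachSet M M.start), (y.length : ZMod d)) ∈ S}

theorem isRegular_reachLanguage [Finite σ] (M : DFA α σ) {d : ℕ} [NeZero d]
    (S : Set (Set σ × ZMod d)) : (reachLanguage M S).IsRegular := by
  refine isRegular_of_mem_iff_of_append_congr
    (f := fun y : List (Set σ) => ((reachSet M M.start :: y).IsChain (· ≥ ·),
      y.getLastD (reachSet M M.start), (y.length : ZMod d)))
    (fun x y b h => ?_) (S := {p | p.1 ∧ p.2 ∈ S}) fun _ => Iff.rfl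
  simp only [Prod.mk.injEq] at h ⊢
  obtain ⟨hchain, hlast, hlength⟩ := h
  rw [List.getLastD_eq_getLast?, List.getLastD_eq_getLast?] at hlast
  simp only [← List.cons_append, List.isChain_append, hchain, List.getLast?_cons, hlast,
    List.getLastD_concat, List.length_append, Nat.cast_add, hlength, and_self]

theorem polynomialGrowth_reverse_reachLanguage [Finite σ] (M : DFA α σ) {d : ℕ}
    (S : Set (Set σ × ZMod d)) : PolynomialGrowth (reachLanguage M S).reverse := by
  refine ⟨Nat.card (Set σ), isBigO_pow_of_le_succ_pow fun n => ?_⟩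
  obtain ⟨hfin, hcard⟩ :=
    Set.encard_le_coe_iff_finite_ncard_le.mp (encard_pairwise_ge_le (T := Set σ) n)
  refine (Set.ncard_le_ncard_of_injOn List.reverse ?_ List.reverse_injective.injOn hfin).trans hcard
  rintro y ⟨⟨hchain, -⟩, hlength⟩
  exact ⟨(List.isChain_iff_pairwise.mp hchain).of_cons, List.length_reverse.trans_le hlength⟩

theorem transduce_mem_reachLanguage_iff {M : DFA α σ} {d : ℕ} {S : Set (Set σ × ZMod d)}
    {x : List α} :
    (reachMealy M).transduce M.start x ∈ reachLanguage M S ↔ reachClass M d x ∈ S := by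
  have hclass : (((reachMealy M).transduce M.start x).getLastD (reachSet M M.start),
      (((reachMealy M).transduce M.start x).length : ZMod d)) = reachClass M d x := by
    rw [getLastD_transduce_reachMealy, MealyMachine.length_transduce]
    rfl
  rw [← hclass]
  exact and_iff_right (isChain_cons_transduce_reachMealy M M.start x)

theorem RecognizedByWellBehavedDFA.exists_leftReducible {L : Language α}
    (h : RecognizedByWellBehavedDFA L.reverse) :
    ∃ (Γ : Type) (_ : Finite Γ) (K : Language Γ),
      K.IsRegular ∧ PolynomialGrowth K ∧ LeftReducible L K := by
  obtain ⟨σ, _, M, d, _, S, hS⟩ := h.exists_reachClass_mem_iff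
  refine ⟨Set σ, inferInstance, (reachLanguage M S).reverse, (isRegular_reachLanguage M S).reverse,
    polynomialGrowth_reverse_reachLanguage M S, σ, inferInstance, reachMealy M, fun x => ?_⟩
  rw [MealyMachine.leftTransduction, Language.reverse_mem_reverse, ← Language.reverse_mem_reverse,
    hS]
  exact transduce_mem_reachLanguage_iff.symm

/-! ### Variable-size windows -/

theorem wnd_append_some (u : List (Option α)) (b : α) : wnd (u ++ [some b]) = wnd u ++ [b] :=
  List.foldl_append

theorem wnd_append_none (u : List (Option α)) : wnd (u ++ [none]) = (wnd u).tail :=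
  List.foldl_append

theorem variableSpace_le_iff {A : StreamingAlgorithm (Option α)} {n s : ℕ} :
    variableSpace A n ≤ s ↔ ∀ u, (∀ v, v <+: u → (wnd v).length ≤ n) →
      ∀ v, v <+: u → (A.enc (A.aut.eval v)).length ≤ s := by
  simp only [variableSpace, StreamingAlgorithm.space, iSup_le_iff, Nat.cast_le]

/-- A digest of words that can be updated when a window slides and that determines the length of
the word and its membership in `L`; these are the states of a variable-size window algorithm. -/
structure WindowDigest (L : Language α) (X : Type) where
  digest : List α → X
  append_congr : ∀ x y b, digest x = digest y → digest (x ++ [b]) = digest (y ++ [b])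
  tail_congr : ∀ x y, digest x = digest y → digest x.tail = digest y.tail
  length_congr : ∀ x y, digest x = digest y → x.length = y.length
  mem_congr : ∀ x y, digest x = digest y → (x ∈ L ↔ y ∈ L)

namespace WindowDigest

variable {L : Language α} {X : Type} (D : WindowDigest L X)

theorem digest_rangeSplitting_rangeFactorization (x : List α) :
    D.digest (Set.rangeSplitting D.digest (Set.rangeFactorization D.digest x)) = D.digest x :=
  Set.apply_rangeSplitting _ _

/-- The algorithm that stores the digest of the window and updates it through an arbitrary word
with that digest. -/
noncomputable def algorithm (enc : Set.range D.digest → List Bool)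
    (henc : Function.Injective enc) : StreamingAlgorithm (Option α) where
  State := Set.range D.digest
  aut :=
    { step := fun q c => Set.rangeFactorization D.digest <| match c with
        | some b => Set.rangeSplitting D.digest q ++ [b]
        | none => (Set.rangeSplitting D.digest q).tail
      start := Set.rangeFactorization D.digest []
      accept := {q | Set.rangeSplitting D.digest q ∈ L} }
  enc := enc
  enc_injective := henc

variable {enc : Set.range D.digest → List Bool} (henc : Function.Injective enc)

theorem eval_algorithm (u : List (Option α)) :
    (D.algorithm enc henc).aut.eval u = Set.rangeFactorization D.digest (wnd u) := by
  induction u using List.reverseRecOn with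
  | nil => rfl
  | append_singleton u c ih =>
    rw [DFA.eval_append_singleton, ih]
    refine Subtype.ext ?_
    cases c with
    | none =>
      rw [wnd_append_none]
      exact D.tail_congr _ _ (D.digest_rangeSplitting_rangeFactorization _)
    | some b =>
      rw [wnd_append_some]
      exact D.append_congr _ _ b (D.digest_rangeSplitting_rangeFactorization _)

theorem isVariableSizeAlgorithm_algorithm :
    IsVariableSizeAlgorithm L (D.algorithm enc henc) := by
  ext u
  rw [DFA.mem_accepts, eval_algorithm]
  exact D.mem_congr _ _ (D.digest_rangeSplitting_rangeFactorization _)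

theorem mem_variableLog {k : ℕ}
    (hcard : ∀ n, (D.digest '' {x | x.length = n}).encard ≤ ((n + 1) ^ k : ℕ)) :
    L ∈ (VariableLog : Set (Language α)) := by
  let size (q : Set.range D.digest) : ℕ := (Set.rangeSplitting D.digest q).length
  have hsize (n : ℕ) : {q | size q = n}.encard ≤ ((n + 1) ^ k : ℕ) := by
    rw [← Subtype.val_injective.encard_image]
    refine (Set.encard_le_encard ?_).trans (hcard n)
    rintro _ ⟨q, hq, rfl⟩
    exact ⟨_, hq, Set.apply_rangeSplitting _ q⟩
  obtain ⟨enc, henc, hbound⟩ := exists_logarithmic_encoding size k hsize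
  refine Set.mem_iUnion₂.mpr ⟨_, log_succ_mul_mem_bigOLog (2 * (k + 1)), D.algorithm enc henc,
    D.isVariableSizeAlgorithm_algorithm henc, fun n => variableSpace_le_iff.mpr fun u hu v hv => ?_⟩
  rw [eval_algorithm]
  refine (hbound _).trans ?_
  have hlength : size (Set.rangeFactorization D.digest (wnd v)) ≤ n :=
    (D.length_congr _ _ (D.digest_rangeSplitting_rangeFactorization _)).trans_le (hu v hv)
  exact Nat.mul_le_mul_right _ (Nat.succ_le_succ (Nat.log_mono_right hlength))

end WindowDigest

/-- The outputs of `reachMealy M` on the reversed window, for all start states: removing the first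
symbol of the window removes the last letter of each output. -/
def reachDigest {L : Language α} {σ : Type} {M : DFA α σ} {d : ℕ} {S : Set (Set σ × ZMod d)}
    (hS : ∀ x, x ∈ L.reverse ↔ reachClass M d x ∈ S) :
    WindowDigest L (σ → List (Set σ)) where
  digest x s := (reachMealy M).transduce s x.reverse
  append_congr x y b h := by
    funext s
    simpa [MealyMachine.transduce] using congrFun h _
  tail_congr x y h := by
    funext s
    simp only [← List.dropLast_reverse, MealyMachine.transduce_dropLast, congrFun h s]
  length_congr x y h := by
    simpa [MealyMachine.length_transduce] using congrArg List.length (congrFun h M.start)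
  mem_congr x y h := by
    rw [← Language.reverse_mem_reverse, hS, ← transduce_mem_reachLanguage_iff, congrFun h M.start,
      transduce_mem_reachLanguage_iff, ← hS, Language.reverse_mem_reverse]

theorem RecognizedByWellBehavedDFA.mem_variableLog {L : Language α}
    (h : RecognizedByWellBehavedDFA L.reverse) : L ∈ (VariableLog : Set (Language α)) := by
  obtain ⟨σ, _, M, d, _, S, hS⟩ := h.exists_reachClass_mem_iff
  refine (reachDigest hS).mem_variableLog (k := Nat.card (Set σ) * Nat.card σ) fun n => ?_
  rw [pow_mul]
  refine le_trans (Set.encard_le_encard ?_)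
    (encard_setOf_forall_mem_le (encard_pairwise_ge_le (T := Set σ) n))
  rintro _ ⟨x, hx, rfl⟩ s
  refine ⟨pairwise_transduce_reachMealy M s _, ?_⟩
  exact ((MealyMachine.length_transduce _ _ _).trans List.length_reverse).trans_le hx.le

/-! ### Simulation of fixed-size windows by variable-size windows -/

/-- The streaming algorithm that feeds `A` with the word `p` and then with `f b` for each input
symbol `b`. Its states are the states of `A` reached in this way, so that a bound on the space used
by `A` on such inputs bounds the encodings of all of them. -/
def StreamingAlgorithm.substitute {β : Type*} (A : StreamingAlgorithm β) (p : List β)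
    (f : α → List β) : StreamingAlgorithm α where
  State := Set.range fun w : List α => A.aut.eval (p ++ w.flatMap f)
  aut :=
    { step := fun q b => ⟨A.aut.evalFrom q (f b), by
        obtain ⟨_, w, rfl⟩ := q
        exact ⟨w ++ [b], by simp [DFA.eval, DFA.evalFrom_of_append]⟩⟩
      start := ⟨A.aut.eval p, [], by simp⟩
      accept := {q | (q : A.State) ∈ A.aut.accept} }
  enc q := A.enc q
  enc_injective := A.enc_injective.comp Subtype.val_injective

theorem StreamingAlgorithm.coe_eval_substitute {β : Type*} (A : StreamingAlgorithm β) (p : List β)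
    (f : α → List β) (w : List α) :
    ((A.substitute p f).aut.eval w).val = A.aut.eval (p ++ w.flatMap f) := by
  induction w using List.reverseRecOn with
  | nil => simp [substitute]
  | append_singleton w b ih =>
    rw [DFA.eval_append_singleton, List.flatMap_append, ← List.append_assoc, eval_append, ← ih,
      List.flatMap_singleton]
    rfl

theorem lastWindow_eq_drop (a : α) (n : ℕ) (w : List α) :
    lastWindow a n w = (List.replicate n a ++ w).drop w.length := by
  rw [List.drop_append, List.drop_replicate, List.length_replicate, lastWindow]

theorem length_lastWindow (a : α) (n : ℕ) (w : List α) : (lastWindow a n w).length = n := by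
  simp [lastWindow_eq_drop]

/-- The stream that fills the window with `n` symbols `a` and then slides it along `w`. -/
def slidingStream (a : α) (n : ℕ) (w : List α) : List (Option α) :=
  List.replicate n (some a) ++ w.flatMap fun b => [some b, none]

theorem slidingStream_append_singleton (a : α) (n : ℕ) (w : List α) (b : α) :
    slidingStream a n (w ++ [b]) = slidingStream a n w ++ [some b] ++ [none] := by
  simp [slidingStream]

theorem wnd_replicate_some (a : α) (n : ℕ) :
    wnd (List.replicate n (some a)) = List.replicate n a := by
  induction n with
  | zero => rfl
  | succ n ih => rw [List.replicate_succ', wnd_append_some, ih, List.replicate_succ']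

theorem wnd_slidingStream (a : α) (n : ℕ) (w : List α) :
    wnd (slidingStream a n w) = lastWindow a n w := by
  induction w using List.reverseRecOn with
  | nil => simp [slidingStream, lastWindow, wnd_replicate_some]
  | append_singleton w b ih =>
    rw [slidingStream_append_singleton, wnd_append_none, wnd_append_some, ih, lastWindow_eq_drop,
      lastWindow_eq_drop, List.length_append, List.length_singleton, ← List.drop_drop,
      List.drop_one, ← List.append_assoc, List.drop_append_of_le_length (l₂ := [b]) (by simp)]

theorem length_wnd_le_of_prefix_slidingStream {a : α} {n : ℕ} {w : List α} {v : List (Option α)}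
    (hv : v <+: slidingStream a n w) : (wnd v).length ≤ n + 1 := by
  induction w using List.reverseRecOn with
  | nil =>
    have hv' : v <+: List.replicate n (some a) := by simpa [slidingStream] using hv
    obtain ⟨hle, hv'⟩ := List.prefix_replicate_iff.mp hv'
    rw [hv', wnd_replicate_some, List.length_replicate]
    omega
  | append_singleton w b ih =>
    rw [slidingStream_append_singleton, List.prefix_concat_iff, List.prefix_concat_iff] at hv
    rcases hv with rfl | rfl | hv
    · rw [wnd_append_none, wnd_append_some, wnd_slidingStream]
      simp [length_lastWindow]
    · rw [wnd_append_some, wnd_slidingStream]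
      simp [length_lastWindow]
    · exact ih hv

theorem mem_fixedLog_of_mem_variableLog (a : α) {L : Language α}
    (hL : L ∈ (VariableLog : Set (Language α))) : L ∈ FixedLog a := by
  obtain ⟨s, hs, A, hA, hspace⟩ := Set.mem_iUnion₂.mp hL
  refine Set.mem_iUnion₂.mpr ⟨_, comp_succ_mem_bigOLog hs,
    fun n => A.substitute (.replicate n (some a)) fun b => [some b, none], fun n => ?_,
    fun n => fixedSpace_le_iff.mpr ?_⟩
  · ext w
    change ((A.substitute _ _).aut.eval w).val ∈ A.aut.accept ↔ lastWindow a n w ∈ L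
    rw [A.coe_eval_substitute, ← wnd_slidingStream, ← DFA.mem_accepts, hA]
    rfl
  · rintro ⟨_, w, rfl⟩
    exact variableSpace_le_iff.mp (hspace (n + 1)) (slidingStream a n w)
      (fun _ hv => length_wnd_le_of_prefix_slidingStream hv) _ List.prefix_rfl

end SlidingWindow

open SlidingWindow in
theorem mainTheorem1_general {α : Type*} (a : α) (L : Language α) (hL : L.IsRegular) :
    [ L ∈ FixedLog a,
      L ∈ (VariableLog : Set (Language α)),
      RecognizedByWellBehavedDFA L.reverse,
      ∃ (Γ : Type) (_ : Finite Γ) (K : Language Γ),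
        K.IsRegular ∧ PolynomialGrowth K ∧ LeftReducible L K,
      L ∈ BooleanSubalgebra.closure (regularGenerators α) ].TFAE := by
  tfae_have 1 → 3 := fun h => by
    obtain ⟨σ, _, B, hB⟩ := hL.reverse
    exact ⟨σ, inferInstance, B, wellBehaved_of_mem_fixedLog hB h, hB⟩
  tfae_have 3 → 2 := fun h => h.mem_variableLog
  tfae_have 2 → 1 := mem_fixedLog_of_mem_variableLog a
  tfae_have 3 → 4 := fun h => h.exists_leftReducible
  tfae_have 4 → 3 := fun ⟨_, _, _, hreg, hgrowth, hred⟩ =>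
    hred.recognizedByWellBehavedDFA_reverse hreg hgrowth
  tfae_have 3 → 5 := fun h => h.mem_closure
  tfae_have 5 → 3 := recognizedByWellBehavedDFA_reverse_of_mem_closure
  tfae_finish

theorem mainTheorem1 {α : Type*} [Finite α] (a : α) (L : Language α) (hL : L.IsRegular) :
    [ L ∈ SlidingWindow.FixedLog a,
      L ∈ (SlidingWindow.VariableLog : Set (Language α)),
      SlidingWindow.RecognizedByWellBehavedDFA L.reverse,
      ∃ (Γ : Type) (_ : Finite Γ) (K : Language Γ),
        K.IsRegular ∧ SlidingWindow.PolynomialGrowth K ∧ SlidingWindow.LeftReducible L K,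
      L ∈ BooleanSubalgebra.closure
        {K : Language α | K.IsRegular ∧
          (SlidingWindow.IsLeftIdeal K ∨ SlidingWindow.IsLengthLanguage K)} ].TFAE :=
  mainTheorem1_general a L hL
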